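/- Let $k \ge 1$ and $K := \binom{k}{2}$. For odd $n$, let $n$ voters choose rankings (linear orderings) of $k$ alternatives independently and uniformly at random among all $k!$ rankings. For each of the $K$ pairs $\{a,b\}$ of alternatives, with a fixed order $(a,b)$, let $S^{(ab)}$ be the number of voters that prefer $a$ to $b$ minus the number of voters that prefer $b$ to $a$, let $Y^{(ab)} := \operatorname{sgn}(S^{(ab)}) \in \{-1,1\}$ (so $a$ beats $b$ if and only if $Y^{(ab)} = 1$), and let $Y \in \{-1,1\}^K$ be the tuple of all $Y^{(ab)}$, which encodes a tournament on the alternatives. For real $d \ge 1$, let $\mathcal{E}_d$ be the event that $|S^{(ab)}| \le d$ for every pair $\{a,b\}$. The tuple $Y$ is transitive if its tournament is induced by a linear ordering of the alternatives, and it has a Condorcet winner if some alternative beats all the others. Then there are constants $\alpha_k, \beta_k, \gamma_k > 0$ depending only on $k$, and functions $\varepsilon_k, \varepsilon'_k, \varepsilon''_k : \mathbb{N} \to \mathbb{R}$ depending only on $k$, each tending to $0$ at infinity, such that for every odd $n$, every real $d \ge 1$ and every $y \in \{-1,1\}^K$, $$\Big| \Pr[\, Y = y \mid \mathcal{E}_d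 \,] - \frac{1}{2^K} \Big| \le \alpha_k \frac{d^2}{n} + \varepsilon_k(n),$$ and, for every odd $n$ and every real $d \ge 1$, $$\Big| \Pr[\, Y \text{ is transitive} \mid \mathcal{E}_d \,] - \frac{k!}{2^K} \Big| \le \beta_k \frac{d^2}{n} + \varepsilon'_k(n),$$ $$\Big| \Pr[\, Y \text{ has a Condorcet winner} \mid \mathcal{E}_d \,] - \frac{k}{2^{k-1}} \Big| \le \gamma_k \frac{d^2}{n} + \varepsilon''_k(n).$$ -/

import Mathlib

open Filter Topology MeasureTheory

/-- A ranking (linear ordering) of `k` alternatives: `σ a` is the position of the alternative `a`,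
and `a` is preferred to `b` when `σ a < σ b`. -/
abbrev Ranking (k : ℕ) := Equiv.Perm (Fin k)

instance Ranking.measurableSpace (k : ℕ) : MeasurableSpace (Ranking k) := ⊤

instance Ranking.discreteMeasurableSpace (k : ℕ) : DiscreteMeasurableSpace (Ranking k) :=
  ⟨fun _ => trivial⟩

/-- A profile: one ranking for each of the `n` voters. -/
abbrev Profile (n k : ℕ) := Fin n → Ranking k

/-- Impartial culture: the `n` voters choose their rankings independently and uniformly. -/
noncomputable def impartialCulture (n k : ℕ) : Measure (Profile n k) :=
  Measure.pi fun _ => (PMF.uniformOfFintype (Ranking k)).toMeasure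

/-- The `k.choose 2` pairs of alternatives, each written in increasing order. -/
abbrev AltPair (k : ℕ) := {p : Fin k × Fin k // p.1 < p.2}

/-- The pairwise margin: the number of voters that prefer `a` to `b` minus the number of voters
that prefer `b` to `a`. -/
def margin {n k : ℕ} (x : Profile n k) (a b : Fin k) : ℤ :=
  ((Finset.univ.filter fun i => x i a < x i b).card : ℤ) -
    ((Finset.univ.filter fun i => x i b < x i a).card : ℤ)

/-- The tuple of pairwise winners: the entry at `(a, b)` is the sign of the margin of `a` over `b`,
so it is `1` if `a` beats `b` and `-1` if `b` beats `a`. -/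
def outcome {n k : ℕ} (x : Profile n k) : AltPair k → ℤ :=
  fun p => (margin x p.1.1 p.1.2).sign

/-- The event that the elections are `d`-close. -/
def closeElections (n k : ℕ) (d : ℝ) : Set (Profile n k) :=
  {x | ∀ p : AltPair k, |(margin x p.1.1 p.1.2 : ℝ)| ≤ d}

/-- In the tournament encoded by the tuple `y`, the alternative `a` beats `b`. -/
def Beats {k : ℕ} (y : AltPair k → ℤ) (a b : Fin k) : Prop :=
  (∃ h : a < b, y ⟨(a, b), h⟩ = 1) ∨ (∃ h : b < a, y ⟨(b, a), h⟩ = -1)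

/-- The tournament is transitive: it is induced by a linear ordering of the alternatives. -/
def IsTransitiveOutcome {k : ℕ} (y : AltPair k → ℤ) : Prop :=
  ∃ σ : Ranking k, ∀ a b : Fin k, Beats y a b ↔ σ a < σ b

/-- Some alternative beats all the others. -/
def HasCondorcetWinner {k : ℕ} (y : AltPair k → ℤ) : Prop :=
  ∃ a : Fin k, ∀ b : Fin k, b ≠ a → Beats y a b

/-- The probability of `A` under impartial culture, conditioned on `d`-close elections. -/
noncomputable def probGivenClose (n k : ℕ) (d : ℝ) (A : Set (Profile n k)) : ℝ :=
  (ProbabilityTheory.cond (impartialCulture n k) (closeElections n k d)).real A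

/-- The conditioning event has positive probability, so `probGivenClose` is a genuine conditional
probability. -/
theorem closeElections_pos {n k : ℕ} (hn : Odd n) {d : ℝ} (hd : 1 ≤ d) :
    0 < impartialCulture n k (closeElections n k d) := by
  classical
  let x : Profile n k := fun i => if Even (i : ℕ) then Equiv.refl _ else Fin.revPerm
  have hx : x ∈ closeElections n k d := by
    rintro ⟨⟨a, b⟩, hab⟩
    have hm : margin x a b = ∑ i : Fin n, (-1 : ℤ) ^ (i : ℕ) := by
      unfold margin
      rw [Finset.card_filter, Finset.card_filter]
      push_cast
      rw [← Finset.sum_sub_distrib]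
      refine Finset.sum_congr rfl fun i _ => ?_
      have hab' : a < b := hab
      by_cases hi : Even (i : ℕ)
      · simp [x, hi, hi.neg_one_pow, hab', hab'.le]
      · simp [x, hi, (Nat.not_even_iff_odd.1 hi).neg_one_pow, hab', hab'.le]
    rw [Fin.sum_univ_eq_sum_range (fun i => (-1 : ℤ) ^ i) n, neg_one_geom_sum,
      if_neg (Nat.not_even_iff_odd.2 hn)] at hm
    simpa [hm] using hd
  refine lt_of_lt_of_le ?_ (measure_mono (Set.singleton_subset_iff.2 hx))
  rw [impartialCulture, Measure.pi_singleton]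
  refine pos_iff_ne_zero.2 (Finset.prod_ne_zero_iff.2 fun i _ => ?_)
  rw [PMF.toMeasure_apply_singleton _ _ (MeasurableSet.singleton _)]
  simp

/-! The vector of margins is a sum of `n` independent steps in `{-1,1}^K`, and the theorem is a
local limit statement: near the origin the law of this sum is flat, with relative error `O(d^2/n)`.
Reversing rankings makes the characteristic function `φ` of one step real, and the common parity of
the margins allows Fourier inversion over `[-π/2, π/2]^K`: the number of profiles with margins `s`
is a constant times `∫ φ^n cos(t·s)` (`sumCount_mul_pi_pow`).

Swapping two adjacent alternatives changes one coordinate of the step only, which gives `|φ| ≤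
exp(-c|t|^2)` on the whole cube (`exists_abs_cosAverage_le_exp`). Since `|cos θ - 1| ≤ θ^2/2`,
replacing `s` by `0` costs `O(d^2/n) n^(-K/2)`, while `∫ φ^n` is at least of order `n^(-K/2)` for
large `n` (`le_integral_cosAverage_pow`). Hence all admissible `s` with entries at most `d` have
nearly the same count `J` (`exists_abs_sumCount_sub_le`).

Each tournament is realised by the same number of admissible `s`, one for each vector of absolute
margins, so all tournaments are nearly equally likely. It remains to count the transitive ones and
those with a Condorcet winner. The finitely many small `n` go into `ε`. -/

section LocalLimit

/-! ### Fourier inversion and decay of the characteristic function -/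

/-- The half-period cube `[-π/2, π/2]^ι`. -/
def halfCube (ι : Type*) : Set (ι → ℝ) :=
  Set.Icc (fun _ => -(Real.pi / 2)) (fun _ => Real.pi / 2)

theorem isCompact_halfCube {ι : Type*} : IsCompact (halfCube ι) := isCompact_Icc

theorem measurableSet_halfCube {ι : Type*} [Countable ι] : MeasurableSet (halfCube ι) := isCompact_halfCube.measurableSet

theorem mem_halfCube {ι : Type*} {t : ι → ℝ} : t ∈ halfCube ι ↔ ∀ p, |t p| ≤ Real.pi / 2 := by
  simp only [halfCube, Set.mem_Icc, Pi.le_def, abs_le, forall_and]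

variable {ι Ω : Type*} [Fintype ι] [Fintype Ω]

/-- The pairing of a real frequency vector with an integer vector. -/
def freqPairing (t : ι → ℝ) (m : ι → ℤ) : ℝ := ∑ p, t p * m p

/-- The real part of the characteristic function of a uniformly chosen value of `X`. -/
noncomputable def cosAverage (X : Ω → ι → ℤ) (t : ι → ℝ) : ℝ :=
  (∑ ω, Real.cos (freqPairing t (X ω))) / Fintype.card Ω

/-- The number of `n`-tuples of samples along which `X` sums to `s`. -/
noncomputable def sumCount (X : Ω → ι → ℤ) (n : ℕ) (s : ι → ℤ) : ℕ :=
  Nat.card {x : Fin n → Ω // ∀ p, ∑ i, X (x i) p = s p}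

theorem continuous_freqPairing (m : ι → ℤ) : Continuous fun t => freqPairing t m := by
  unfold freqPairing; fun_prop

theorem continuous_cosAverage (X : Ω → ι → ℤ) : Continuous (cosAverage X) := by
  unfold cosAverage
  have := fun ω => continuous_freqPairing (X ω)
  fun_prop

/-- An even frequency has period `π`, so the characters are already orthogonal over a half period.
-/
theorem integral_exp_mul_even {m : ℤ} (hm : Even m) :
    ∫ t in Set.Icc (-(Real.pi / 2)) (Real.pi / 2), Complex.exp (Complex.I * m * (t : ℂ)) =
      if m = 0 then (Real.pi : ℂ) else 0 := by
  rw [integral_Icc_eq_integral_Ioc, ← intervalIntegral.integral_of_le (by linarith [Real.pi_pos])]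
  split_ifs with h
  · subst h
    simp only [Int.cast_zero, mul_zero, zero_mul, Complex.exp_zero,
      intervalIntegral.integral_const]
    simp
  · have hc : Complex.I * (m : ℂ) ≠ 0 := mul_ne_zero Complex.I_ne_zero (by exact_mod_cast h)
    rw [integral_exp_mul_complex hc]
    obtain ⟨j, rfl⟩ := hm
    have : Complex.exp (Complex.I * ((j + j : ℤ) : ℂ) * ((Real.pi / 2 : ℝ) : ℂ)) =
        Complex.exp (Complex.I * ((j + j : ℤ) : ℂ) * ((-(Real.pi / 2) : ℝ) : ℂ)) := by
      rw [Complex.exp_eq_exp_iff_exists_int]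
      exact ⟨j, by push_cast; ring⟩
    rw [this, sub_self, zero_div]

theorem integral_cos_freqPairing_even {m : ι → ℤ} (hm : ∀ p, Even (m p)) :
    ∫ t in halfCube ι, Real.cos (freqPairing t m) =
      if m = 0 then Real.pi ^ Fintype.card ι else 0 := by
  have hre : ∀ t : ι → ℝ, Real.cos (freqPairing t m) =
      RCLike.re (∏ p, Complex.exp (Complex.I * m p * (t p : ℂ))) := by
    intro t
    rw [← Complex.exp_sum, RCLike.re_to_complex]
    have : ∑ p, Complex.I * (m p : ℂ) * (t p : ℂ) = (freqPairing t m : ℂ) * Complex.I := by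
      rw [freqPairing, Complex.ofReal_sum, Finset.sum_mul]
      refine Finset.sum_congr rfl fun p _ => ?_
      push_cast; ring
    rw [this, Complex.exp_ofReal_mul_I_re]
  simp_rw [hre]
  rw [integral_re]
  · have hQ : halfCube ι =
        Set.pi Set.univ fun _ : ι => Set.Icc (-(Real.pi / 2)) (Real.pi / 2) :=
      (Set.pi_univ_Icc _ _).symm
    rw [hQ, volume_pi, Measure.restrict_pi_pi,
      integral_fintype_prod_eq_prod
        (fun p (t : ℝ) => Complex.exp (Complex.I * m p * (t : ℂ)))]
    simp_rw [integral_exp_mul_even (hm _)]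
    split_ifs with h
    · subst h
      simp [← Complex.ofReal_pow]
    · obtain ⟨p, hp⟩ := Function.ne_iff.1 h
      rw [Finset.prod_eq_zero (Finset.mem_univ p) (if_neg hp)]
      simp
  · exact ContinuousOn.integrableOn_compact isCompact_halfCube (by fun_prop)

/-- The symmetry `r` cancels the sines, so the characteristic function is real. -/
theorem sum_exp_freqPairing (X : Ω → ι → ℤ) [Nonempty Ω] (r : Ω ≃ Ω)
    (hr : ∀ ω p, X (r ω) p = -X ω p) (t : ι → ℝ) :
    ∑ ω, Complex.exp (freqPairing t (X ω) * Complex.I) =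
      ((Fintype.card Ω * cosAverage X t : ℝ) : ℂ) := by
  have hneg : ∀ ω, freqPairing t (X (r ω)) = -freqPairing t (X ω) := by
    intro ω
    simp [freqPairing, hr, Finset.sum_neg_distrib]
  have hs : ∑ ω, Real.sin (freqPairing t (X ω)) = 0 := by
    have h := Equiv.sum_comp r fun ω => Real.sin (freqPairing t (X ω))
    simp only [hneg, Real.sin_neg, Finset.sum_neg_distrib] at h
    linarith
  have hcard : (Fintype.card Ω : ℝ) ≠ 0 := by exact_mod_cast Fintype.card_ne_zero
  rw [cosAverage, mul_div_cancel₀ _ hcard]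
  apply Complex.ext
  · simp only [Complex.re_sum, Complex.exp_ofReal_mul_I_re, Complex.ofReal_re]
  · simp only [Complex.im_sum, Complex.exp_ofReal_mul_I_im, hs, Complex.ofReal_im]

theorem sum_cos_freqPairing_sum (X : Ω → ι → ℤ) [Nonempty Ω] (r : Ω ≃ Ω)
    (hr : ∀ ω p, X (r ω) p = -X ω p) (n : ℕ) (s : ι → ℤ) (t : ι → ℝ) :
    ∑ x : Fin n → Ω, Real.cos (freqPairing t fun p => ∑ i, X (x i) p - s p) =
      (Fintype.card Ω : ℝ) ^ n * (cosAverage X t ^ n * Real.cos (freqPairing t s)) := by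
  classical
  have key : ∑ x : Fin n → Ω,
      Complex.exp ((freqPairing t fun p => ∑ i, X (x i) p - s p : ℝ) * Complex.I) =
      (((Fintype.card Ω * cosAverage X t) ^ n : ℝ) : ℂ) *
        Complex.exp ((-freqPairing t s : ℝ) * Complex.I) := by
    rw [Complex.ofReal_pow, ← sum_exp_freqPairing X r hr t, Fintype.sum_pow, Finset.sum_mul]
    refine Finset.sum_congr rfl fun x _ => ?_
    rw [← Complex.exp_sum, ← Complex.exp_add, ← Finset.sum_mul, ← add_mul, ← Complex.ofReal_sum,
      ← Complex.ofReal_add]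
    congr 3
    simp only [freqPairing, Int.cast_sub, Int.cast_sum, mul_sub, Finset.mul_sum,
      Finset.sum_sub_distrib]
    rw [Finset.sum_comm, sub_eq_add_neg]
  have h := congrArg Complex.re key
  rw [Complex.re_sum, Complex.re_ofReal_mul] at h
  simp only [Complex.exp_ofReal_mul_I_re, Real.cos_neg] at h
  rw [h, mul_pow, mul_assoc]

/-- Fourier inversion for the law of a sum of independent uniform samples of `X`. -/
theorem sumCount_mul_pi_pow (X : Ω → ι → ℤ) [Nonempty Ω] (r : Ω ≃ Ω)
    (hr : ∀ ω p, X (r ω) p = -X ω p) (n : ℕ) (s : ι → ℤ)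
    (hs : ∀ (x : Fin n → Ω) p, Even (∑ i, X (x i) p - s p)) :
    (sumCount X n s : ℝ) * Real.pi ^ Fintype.card ι =
      (Fintype.card Ω : ℝ) ^ n *
        ∫ t in halfCube ι, cosAverage X t ^ n * Real.cos (freqPairing t s) := by
  classical
  rw [← integral_const_mul]
  simp_rw [← sum_cos_freqPairing_sum X r hr n s]
  rw [integral_finsetSum]
  · simp_rw [integral_cos_freqPairing_even (hs _)]
    rw [Finset.sum_ite, Finset.sum_const_zero, add_zero, Finset.sum_const, nsmul_eq_mul,
      sumCount, Nat.card_eq_fintype_card, Fintype.card_subtype]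
    congr 3
    ext x
    simp [funext_iff, sub_eq_zero]
  · intro x _
    exact ContinuousOn.integrableOn_compact isCompact_halfCube
      (Real.continuous_cos.comp (continuous_freqPairing _)).continuousOn

/-- If `A` is the common contribution of the other coordinates, the two samples add up to `2 cos A
cos (t p)`. Only `cos (t p)` is estimated, and every other sample is bounded by `1`. The half period
is essential: at `t p = π` the factor has modulus `1` again. -/
theorem abs_cosAverage_le_of_flip (X : Ω → ι → ℤ) {p : ι} {ω ω' : Ω}
    (h1 : X ω p = 1) (h2 : X ω' p = -1) (h : ∀ q, q ≠ p → X ω q = X ω' q) (t : ι → ℝ)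
    (ht : |t p| ≤ Real.pi / 2) :
    |cosAverage X t| ≤ 1 - 4 / (Real.pi ^ 2 * Fintype.card Ω) * t p ^ 2 := by
  classical
  have hne : ω ≠ ω' := by rintro rfl; omega
  have hcard : (0 : ℝ) < Fintype.card Ω := by exact_mod_cast Fintype.card_pos_iff.2 ⟨ω⟩
  have hsum : ∀ f : Ω → ℝ, ∑ v, f v = f ω + f ω' + ∑ v ∈ Finset.univ \ {ω, ω'}, f v := by
    intro f
    rw [← Finset.sum_pair hne, add_comm, Finset.sum_sdiff (Finset.subset_univ _)]
  set A := ∑ q ∈ Finset.univ.erase p, t q * (X ω q : ℝ) with hA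
  have e1 : freqPairing t (X ω) = A + t p := by
    rw [freqPairing, ← Finset.sum_erase_add _ _ (Finset.mem_univ p), h1]; simp [hA]
  have e2 : freqPairing t (X ω') = A - t p := by
    rw [freqPairing, ← Finset.sum_erase_add _ _ (Finset.mem_univ p), h2, hA]
    rw [Finset.sum_congr rfl fun q hq =>
      show t q * (X ω q : ℝ) = t q * X ω' q by rw [h q (Finset.ne_of_mem_erase hq)]]
    push_cast; ring
  have hcos : |Real.cos (A + t p) + Real.cos (A - t p)| ≤ 2 - 4 / Real.pi ^ 2 * t p ^ 2 := by
    have : Real.cos (A + t p) + Real.cos (A - t p) = 2 * (Real.cos A * Real.cos (t p)) := by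
      rw [Real.cos_add, Real.cos_sub]; ring
    rw [this, abs_mul, abs_mul, abs_two]
    have c0 : 0 ≤ Real.cos (t p) := Real.cos_nonneg_of_mem_Icc ⟨by linarith [abs_le.1 ht], (abs_le.1 ht).2⟩
    have c1 : Real.cos (t p) ≤ 1 - 2 / Real.pi ^ 2 * t p ^ 2 :=
      Real.cos_le_one_sub_mul_cos_sq (by linarith [Real.pi_pos])
    have c2 := Real.abs_cos_le_one A
    rw [abs_of_nonneg c0]
    have : |Real.cos A| * Real.cos (t p) ≤ 1 * Real.cos (t p) := by gcongr
    have e : 4 / Real.pi ^ 2 = 2 * (2 / Real.pi ^ 2) := by ring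
    rw [e]; nlinarith
  have hrest : |∑ v ∈ Finset.univ \ {ω, ω'}, Real.cos (freqPairing t (X v))| ≤
      Fintype.card Ω - 2 := by
    calc _ ≤ ∑ v ∈ Finset.univ \ {ω, ω'}, (1 : ℝ) :=
          (Finset.abs_sum_le_sum_abs _ _).trans (Finset.sum_le_sum fun v _ => Real.abs_cos_le_one _)
      _ = Fintype.card Ω - 2 := by
          have := hsum fun _ => (1 : ℝ)
          simp only [Finset.sum_const, Finset.card_univ, nsmul_eq_mul, mul_one] at this ⊢
          linarith
  rw [cosAverage, abs_div, abs_of_pos hcard, div_le_iff₀ hcard, hsum, e1, e2]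
  refine (abs_add_le _ _).trans ((add_le_add hcos hrest).trans (le_of_eq ?_))
  field_simp
  ring

theorem exists_abs_cosAverage_le_exp (X : Ω → ι → ℤ) [Nonempty Ω]
    (hflip : ∀ p, ∃ ω ω', X ω p = 1 ∧ X ω' p = -1 ∧ ∀ q, q ≠ p → X ω q = X ω' q) :
    ∃ c : ℝ, 0 < c ∧ ∀ t ∈ halfCube ι, |cosAverage X t| ≤ Real.exp (-c * ∑ p, t p ^ 2) := by
  have hcard : (0 : ℝ) < Fintype.card Ω := by exact_mod_cast Fintype.card_pos
  set b : ℝ := 4 / (Real.pi ^ 2 * Fintype.card Ω) with hb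
  have hb0 : 0 < b := by have := Real.pi_pos; positivity
  -- The coordinate bounds are averaged together with `|φ| ≤ 1`; this extra bound accounts for the
  -- `+ 1`, which also covers an empty `ι`.
  refine ⟨b / (Fintype.card ι + 1), by positivity, fun t ht => ?_⟩
  have hle : ∀ p, |cosAverage X t| ≤ 1 - b * t p ^ 2 := by
    intro p
    obtain ⟨ω, ω', h1, h2, h⟩ := hflip p
    exact abs_cosAverage_le_of_flip X h1 h2 h t (mem_halfCube.1 ht p)
  have h1 : |cosAverage X t| ≤ 1 := by
    rw [cosAverage, abs_div, abs_of_pos hcard, div_le_one hcard]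
    refine (Finset.abs_sum_le_sum_abs _ _).trans
      ((Finset.sum_le_sum fun v _ => Real.abs_cos_le_one _).trans ?_)
    simp
  have hsum := Finset.sum_le_sum fun p (_ : p ∈ Finset.univ) => hle p
  rw [Finset.sum_const, Finset.sum_sub_distrib, ← Finset.mul_sum] at hsum
  simp only [Finset.card_univ, nsmul_eq_mul, Finset.sum_const, mul_one] at hsum
  have : |cosAverage X t| ≤ 1 - b / (Fintype.card ι + 1) * ∑ p, t p ^ 2 := by
    have hK : (0 : ℝ) < Fintype.card ι + 1 := by positivity
    rw [div_mul_eq_mul_div, ← sub_nonneg]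
    rw [show 1 - b * (∑ p, t p ^ 2) / ((Fintype.card ι : ℝ) + 1) - |cosAverage X t| =
      (((Fintype.card ι : ℝ) + 1) * (1 - |cosAverage X t|) - b * ∑ p, t p ^ 2) /
        ((Fintype.card ι : ℝ) + 1) by field_simp; ring]
    apply div_nonneg _ hK.le
    linarith
  refine this.trans ?_
  have := Real.add_one_le_exp (-(b / (Fintype.card ι + 1)) * ∑ p, t p ^ 2)
  linarith

end LocalLimit

/-! ### Gaussian estimates and flatness near the origin -/

section LocalLimit

variable {ι Ω : Type*} [Fintype ι] [Fintype Ω]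

theorem integrable_exp_neg_mul_sum_sq {b : ℝ} (hb : 0 < b) :
    Integrable fun t : ι → ℝ => Real.exp (-b * ∑ p, t p ^ 2) := by
  simp_rw [Finset.mul_sum, Real.exp_sum]
  exact Integrable.fintype_prod fun _ => integrable_exp_neg_mul_sq hb

theorem integral_comp_sqrt_smul (n : ℕ) (f : (ι → ℝ) → ℝ) :
    ∫ t, f (Real.sqrt n • t) = (Real.sqrt n ^ Fintype.card ι)⁻¹ * ∫ t, f t := by
  rw [Measure.integral_comp_smul_of_nonneg volume f (hR := Real.sqrt_nonneg _), smul_eq_mul,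
    Module.finrank_fintype_fun_eq_card]

theorem integral_exp_neg_mul_sum_sq_scale (b : ℝ) (n : ℕ) :
    ∫ t : ι → ℝ, Real.exp (-(n * b) * ∑ p, t p ^ 2) =
      (Real.sqrt n ^ Fintype.card ι)⁻¹ * ∫ t : ι → ℝ, Real.exp (-b * ∑ p, t p ^ 2) := by
  rw [← integral_comp_sqrt_smul]
  congr 1
  ext t
  simp only [Pi.smul_apply, smul_eq_mul, mul_pow, Real.sq_sqrt (Nat.cast_nonneg n),
    ← Finset.mul_sum]
  ring_nf

/-- Half of the exponent absorbs the factor `q`, through `x ≤ exp x` at `x = c q / 2`. -/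
theorem mul_exp_neg_le {c q : ℝ} (hc : 0 < c) :
    q * Real.exp (-c * q) ≤ 2 / c * Real.exp (-(c / 2) * q) := by
  have h := Real.add_one_le_exp (c / 2 * q)
  have e : Real.exp (-(c / 2) * q) = Real.exp (c / 2 * q) * Real.exp (-c * q) := by
    rw [← Real.exp_add]; ring_nf
  rw [e, ← mul_assoc]
  gcongr
  rw [div_mul_eq_mul_div, le_div_iff₀ hc]
  linarith

theorem sq_freqPairing_le (t : ι → ℝ) (m : ι → ℤ) {d : ℝ} (hm : ∀ p, |(m p : ℝ)| ≤ d) :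
    freqPairing t m ^ 2 ≤ Fintype.card ι * d ^ 2 * ∑ p, t p ^ 2 := by
  have h : ∑ p, (m p : ℝ) ^ 2 ≤ Fintype.card ι * d ^ 2 := by
    have := Finset.sum_le_sum fun p (_ : p ∈ Finset.univ) =>
      sq_le_sq' (by linarith [abs_le.1 (hm p)]) (abs_le.1 (hm p)).2
    simpa using this
  rw [freqPairing, mul_comm]
  refine (Finset.sum_mul_sq_le_sq_mul_sq _ _ _).trans ?_
  gcongr

/-- The second moment gains a factor `1/n` over the Gaussian mass `n^(-K/2)`; this is the source of
the `1/n` in the final bound. -/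
theorem setIntegral_sum_sq_mul_exp_le {c : ℝ} (hc : 0 < c) {n : ℕ} (hn : 0 < n) :
    ∫ t in halfCube ι, (∑ p, t p ^ 2) * Real.exp (-(n * c) * ∑ p, t p ^ 2) ≤
      2 / (n * c) * ((Real.sqrt n ^ Fintype.card ι)⁻¹ *
        ∫ t : ι → ℝ, Real.exp (-(c / 2) * ∑ p, t p ^ 2)) := by
  have hn' : (0 : ℝ) < n := by exact_mod_cast hn
  rw [← integral_exp_neg_mul_sum_sq_scale, ← integral_const_mul]
  have hint : Integrable fun t : ι → ℝ =>
      2 / (n * c) * Real.exp (-(n * (c / 2)) * ∑ p, t p ^ 2) :=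
    (integrable_exp_neg_mul_sum_sq (by positivity)).const_mul _
  refine (setIntegral_mono_on ?_ hint.integrableOn measurableSet_halfCube
    (fun t _ => ?_)).trans (setIntegral_le_integral hint (Eventually.of_forall fun t => ?_))
  · exact ContinuousOn.integrableOn_compact isCompact_halfCube (by fun_prop)
  · have := mul_exp_neg_le (q := ∑ p, t p ^ 2) (mul_pos hn' hc)
    rwa [mul_div_assoc] at this
  · have := mul_pos hn' hc
    simp only [Pi.zero_apply]
    positivity

theorem abs_cosAverage_pow_le {X : Ω → ι → ℤ} {c : ℝ}
    (hX : ∀ t ∈ halfCube ι, |cosAverage X t| ≤ Real.exp (-c * ∑ p, t p ^ 2)) (n : ℕ)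
    {t : ι → ℝ} (ht : t ∈ halfCube ι) :
    |cosAverage X t ^ n| ≤ Real.exp (-(n * c) * ∑ p, t p ^ 2) := by
  rw [abs_pow]
  refine (pow_le_pow_left₀ (abs_nonneg _) (hX t ht) n).trans (le_of_eq ?_)
  rw [← Real.exp_nat_mul]
  ring_nf

theorem abs_integral_cosAverage_sub_le {X : Ω → ι → ℤ} {c : ℝ} (hc : 0 < c)
    (hX : ∀ t ∈ halfCube ι, |cosAverage X t| ≤ Real.exp (-c * ∑ p, t p ^ 2)) {n : ℕ}
    (hn : 0 < n) (s : ι → ℤ) {d : ℝ} (hs : ∀ p, |(s p : ℝ)| ≤ d) :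
    |(∫ t in halfCube ι, cosAverage X t ^ n * Real.cos (freqPairing t s)) -
        ∫ t in halfCube ι, cosAverage X t ^ n| ≤
      Fintype.card ι * d ^ 2 / 2 * (2 / (n * c) * ((Real.sqrt n ^ Fintype.card ι)⁻¹ *
        ∫ t : ι → ℝ, Real.exp (-(c / 2) * ∑ p, t p ^ 2))) := by
  have hφ := continuous_cosAverage X
  have hf := continuous_freqPairing s
  have i1 : IntegrableOn (fun t => cosAverage X t ^ n * Real.cos (freqPairing t s))
      (halfCube ι) := ContinuousOn.integrableOn_compact isCompact_halfCube (by fun_prop)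
  have i2 : IntegrableOn (fun t => cosAverage X t ^ n) (halfCube ι) :=
    ContinuousOn.integrableOn_compact isCompact_halfCube (by fun_prop)
  rw [← integral_sub i1 i2]
  refine (abs_integral_le_integral_abs).trans
    (le_trans ?_ (mul_le_mul_of_nonneg_left (setIntegral_sum_sq_mul_exp_le hc hn) (by positivity)))
  rw [← integral_const_mul]
  refine setIntegral_mono_on (i1.sub i2).abs
    (ContinuousOn.integrableOn_compact isCompact_halfCube (by fun_prop)) measurableSet_halfCube
    fun t ht => ?_
  have h1 := abs_cosAverage_pow_le hX n ht
  have h2 := sq_freqPairing_le t s hs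
  have h3 : |Real.cos (freqPairing t s) - 1| ≤ freqPairing t s ^ 2 / 2 := by
    rw [abs_le]
    constructor
    · linarith [Real.one_sub_sq_div_two_le_cos (x := freqPairing t s)]
    · linarith [Real.cos_le_one (freqPairing t s), sq_nonneg (freqPairing t s)]
  rw [← mul_sub_one, abs_mul]
  calc _ ≤ Real.exp (-(n * c) * ∑ p, t p ^ 2) *
        (Fintype.card ι * d ^ 2 * (∑ p, t p ^ 2) / 2) := by
        gcongr
        linarith
    _ = _ := by ring

theorem one_sub_le_cosAverage (X : Ω → ι → ℤ) [Nonempty Ω]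
    (hX : ∀ ω p, |(X ω p : ℝ)| ≤ 1) (t : ι → ℝ) :
    1 - Fintype.card ι * (∑ p, t p ^ 2) / 2 ≤ cosAverage X t := by
  have hcard : (0 : ℝ) < Fintype.card Ω := by exact_mod_cast Fintype.card_pos
  rw [cosAverage, le_div_iff₀ hcard]
  have h : ∀ ω, 1 - Fintype.card ι * (∑ p, t p ^ 2) / 2 ≤ Real.cos (freqPairing t (X ω)) := by
    intro ω
    have h1 := sq_freqPairing_le t (X ω) (hX ω)
    have h2 := Real.one_sub_sq_div_two_le_cos (x := freqPairing t (X ω))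
    linarith
  have := Finset.sum_le_sum fun ω (_ : ω ∈ Finset.univ) => h ω
  rw [Finset.sum_const, nsmul_eq_mul, Finset.card_univ] at this
  linarith

/-- At scale `1/√n` Bernoulli's inequality gives `φ^n ≥ 1/2`. Elsewhere `φ^n` can be negative only
where `K|t|^2 > 1`, and there its Gaussian bound is dominated by the subtracted term. -/
theorem indicator_sub_le_cosAverage_pow {X : Ω → ι → ℤ} [Nonempty Ω]
    (hX1 : ∀ ω p, |(X ω p : ℝ)| ≤ 1) {c : ℝ}
    (hX : ∀ t ∈ halfCube ι, |cosAverage X t| ≤ Real.exp (-c * ∑ p, t p ^ 2)) {n : ℕ}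
    (hn : 0 < n) {t : ι → ℝ} (ht : t ∈ halfCube ι) :
    (Metric.closedBall (0 : ι → ℝ) (1 / (Fintype.card ι + 1))).indicator (fun _ => 1 / 2)
        (Real.sqrt n • t) -
      Fintype.card ι * ((∑ p, t p ^ 2) * Real.exp (-(n * c) * ∑ p, t p ^ 2)) ≤
      cosAverage X t ^ n := by
  have hn' : (0 : ℝ) < n := by exact_mod_cast hn
  set K : ℝ := (Fintype.card ι : ℝ) with hK
  have hK0 : 0 ≤ K := Nat.cast_nonneg _
  set q := ∑ p, t p ^ 2 with hq
  have hq0 : 0 ≤ q := Finset.sum_nonneg fun _ _ => sq_nonneg _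
  have hlow : 1 - K * q / 2 ≤ cosAverage X t := one_sub_le_cosAverage X hX1 t
  have hup := abs_cosAverage_pow_le hX n ht
  have hE := Real.exp_pos (-(n * c) * q)
  have hterm : 0 ≤ K * (q * Real.exp (-(n * c) * q)) := by positivity
  by_cases hb : Real.sqrt n • t ∈ Metric.closedBall (0 : ι → ℝ) (1 / (K + 1))
  · rw [Set.indicator_of_mem hb]
    rw [mem_closedBall_zero_iff] at hb
    -- The radius `1/(K+1)` is chosen so that `K n q ≤ K^2/(K+1)^2 ≤ 1`, whence `φ ≥ 1 - 1/(2n)`.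
    have hnq : n * q ≤ K * (1 / (K + 1)) ^ 2 := by
      have : ∀ p, n * t p ^ 2 ≤ (1 / (K + 1)) ^ 2 := by
        intro p
        have h := (norm_le_pi_norm (Real.sqrt n • t) p).trans hb
        rw [Real.norm_eq_abs] at h
        have h2 := sq_le_sq' (by linarith [abs_le.1 h]) (abs_le.1 h).2
        rwa [Pi.smul_apply, smul_eq_mul, mul_pow, Real.sq_sqrt hn'.le] at h2
      have := Finset.sum_le_sum fun p (_ : p ∈ Finset.univ) => this p
      rw [← Finset.mul_sum, Finset.sum_const, Finset.card_univ, nsmul_eq_mul] at this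
      exact this
    have hKnq : K * (n * q) ≤ 1 := by
      refine (mul_le_mul_of_nonneg_left hnq hK0).trans ?_
      rw [one_div, inv_pow, ← mul_assoc, ← div_eq_mul_inv, div_le_one (by positivity)]
      nlinarith
    have h1 : 1 - 1 / (2 * n) ≤ cosAverage X t := by
      refine le_trans ?_ hlow
      have : K * q ≤ 1 / n := by rw [le_div_iff₀ hn']; linarith
      have e : 1 / (2 * (n : ℝ)) = 1 / n / 2 := by field_simp
      rw [e]; linarith
    have hn1 : (1 : ℝ) ≤ n := by exact_mod_cast hn
    have h0 : 1 / (2 * (n : ℝ)) ≤ 1 / 2 := by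
      apply one_div_le_one_div_of_le <;> linarith
    have h2 := one_add_mul_le_pow (a := -(1 / (2 * (n : ℝ)))) (by linarith) n
    have e : 1 + (n : ℝ) * -(1 / (2 * (n : ℝ))) = 1 / 2 := by field_simp; ring
    rw [e] at h2
    have h3 := pow_le_pow_left₀ (n := n) (by linarith) h1
    rw [← sub_eq_add_neg] at h2
    linarith
  · rw [Set.indicator_of_notMem hb]
    by_cases h1 : K * q ≤ 1
    · have : 0 ≤ cosAverage X t ^ n := pow_nonneg (by linarith) n
      linarith
    · have := (abs_le.1 hup).1
      have : 1 * Real.exp (-(n * c) * q) ≤ K * q * Real.exp (-(n * c) * q) := by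
        gcongr; linarith
      linarith

theorem le_integral_cosAverage_pow {X : Ω → ι → ℤ} [Nonempty Ω]
    (hX1 : ∀ ω p, |(X ω p : ℝ)| ≤ 1) {c : ℝ} (hc : 0 < c)
    (hX : ∀ t ∈ halfCube ι, |cosAverage X t| ≤ Real.exp (-c * ∑ p, t p ^ 2)) {n : ℕ}
    (hn : 0 < n) :
    (Real.sqrt n ^ Fintype.card ι)⁻¹ *
          (volume.real (Metric.closedBall (0 : ι → ℝ) (1 / (Fintype.card ι + 1))) / 2) -
        Fintype.card ι * (2 / (n * c) * ((Real.sqrt n ^ Fintype.card ι)⁻¹ *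
          ∫ t : ι → ℝ, Real.exp (-(c / 2) * ∑ p, t p ^ 2))) ≤
      ∫ t in halfCube ι, cosAverage X t ^ n := by
  have hn1 : (1 : ℝ) ≤ n := by exact_mod_cast hn
  set r : ℝ := 1 / (Fintype.card ι + 1) with hr
  have hr0 : 0 < r := by positivity
  have hr1 : r ≤ 1 := by
    rw [hr, div_le_one (by positivity)]; linarith [(Nat.cast_nonneg (Fintype.card ι) : (0:ℝ) ≤ _)]
  set g : (ι → ℝ) → ℝ := (Metric.closedBall (0 : ι → ℝ) r).indicator fun _ => 1 / 2 with hg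
  have hs0 : Real.sqrt n ≠ 0 := (Real.sqrt_pos.2 (by linarith)).ne'
  have hgint : Integrable g :=
    (integrable_indicator_iff measurableSet_closedBall).2
      (integrableOn_const (measure_closedBall_lt_top.ne))
  have hgs : Integrable fun t => g (Real.sqrt n • t) := hgint.comp_smul hs0
  have hgI : ∫ t in halfCube ι, g (Real.sqrt n • t) =
      (Real.sqrt n ^ Fintype.card ι)⁻¹ *
        (volume.real (Metric.closedBall (0 : ι → ℝ) r) / 2) := by
    rw [setIntegral_eq_integral_of_forall_compl_eq_zero, integral_comp_sqrt_smul]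
    · rw [hg, integral_indicator measurableSet_closedBall, setIntegral_const, smul_eq_mul]
      ring
    -- The rescaled ball lies inside the cube, because `√n ≥ 1` and `r ≤ 1 < π/2`.
    · intro t ht
      refine Set.indicator_of_notMem (fun h => ht (mem_halfCube.2 fun p => ?_)) _
      rw [mem_closedBall_zero_iff] at h
      have h1 := (norm_le_pi_norm (Real.sqrt n • t) p).trans h
      rw [Pi.smul_apply, smul_eq_mul, norm_mul, Real.norm_eq_abs, Real.norm_eq_abs,
        abs_of_nonneg (Real.sqrt_nonneg _)] at h1
      have h2 : 1 ≤ Real.sqrt n := Real.one_le_sqrt.2 hn1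
      have h3 : 1 * |t p| ≤ Real.sqrt n * |t p| := by gcongr
      linarith [Real.pi_gt_three]
  have hφ := continuous_cosAverage X
  have i2 : IntegrableOn (fun t => cosAverage X t ^ n) (halfCube ι) :=
    ContinuousOn.integrableOn_compact isCompact_halfCube (by fun_prop)
  have i3 : IntegrableOn (fun t : ι → ℝ => (Fintype.card ι : ℝ) *
      ((∑ p, t p ^ 2) * Real.exp (-(n * c) * ∑ p, t p ^ 2))) (halfCube ι) :=
    ContinuousOn.integrableOn_compact isCompact_halfCube (by fun_prop)
  have key := setIntegral_mono_on (hgs.integrableOn.sub i3) i2 measurableSet_halfCube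
    fun t ht => indicator_sub_le_cosAverage_pow hX1 hX hn ht
  simp only [Pi.sub_apply] at key
  rw [integral_sub hgs.integrableOn i3, hgI, integral_const_mul] at key
  refine le_trans ?_ key
  have := setIntegral_sum_sq_mul_exp_le (ι := ι) hc hn
  gcongr

/-- Near the origin the law of the sum of `n` uniform samples of `X` is flat, up to a relative
error that is quadratic in the distance to the origin. -/
theorem exists_abs_sumCount_sub_le (X : Ω → ι → ℤ) [Nonempty Ω]
    (hX1 : ∀ ω p, |(X ω p : ℝ)| ≤ 1) (r : Ω ≃ Ω) (hr : ∀ ω p, X (r ω) p = -X ω p)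
    (hflip : ∀ p, ∃ ω ω', X ω p = 1 ∧ X ω' p = -1 ∧ ∀ q, q ≠ p → X ω q = X ω' q) :
    ∃ C : ℝ, 0 < C ∧ ∃ N : ℕ, ∀ n, N ≤ n → ∃ J : ℝ, 0 < J ∧ ∀ (s : ι → ℤ) (d : ℝ),
      (∀ (x : Fin n → Ω) p, Even (∑ i, X (x i) p - s p)) → (∀ p, |(s p : ℝ)| ≤ d) →
        |(sumCount X n s : ℝ) - J| ≤ C * (d ^ 2 / n) * J := by
  obtain ⟨c, hc, hX⟩ := exists_abs_cosAverage_le_exp X hflip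
  set K : ℝ := (Fintype.card ι : ℝ) with hK
  have hK0 : 0 ≤ K := Nat.cast_nonneg _
  set v : ℝ := volume.real (Metric.closedBall (0 : ι → ℝ) (1 / (K + 1))) with hv
  have hv0 : 0 < v :=
    ENNReal.toReal_pos (Metric.measure_closedBall_pos volume 0 (by positivity)).ne'
      measure_closedBall_lt_top.ne
  set G : ℝ := ∫ t : ι → ℝ, Real.exp (-(c / 2) * ∑ p, t p ^ 2) with hG
  have hG0 : 0 ≤ G := integral_nonneg fun t => (Real.exp_pos _).le
  -- Beyond `N` the error term takes away at most half of the main term, which leaves `a * (v / 4)`.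
  obtain ⟨N, hN⟩ := exists_nat_gt (K * (2 / c) * G * (4 / v))
  -- The `+ 1` only makes the constant positive, also when `K = 0`.
  refine ⟨K * G / c * (4 / v) + 1, by positivity, N + 1, fun n hn => ?_⟩
  have hn0 : 0 < n := by omega
  have hn' : (0 : ℝ) < n := by exact_mod_cast hn0
  have hNn : (N : ℝ) ≤ n := by exact_mod_cast (by omega : N ≤ n)
  set a : ℝ := (Real.sqrt n ^ Fintype.card ι)⁻¹ with ha
  have ha0 : 0 < a := inv_pos.2 (pow_pos (Real.sqrt_pos.2 hn') _)
  set I := ∫ t in halfCube ι, cosAverage X t ^ n with hI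
  have hIlow : a * (v / 4) ≤ I := by
    refine le_trans ?_ (le_integral_cosAverage_pow hX1 hc hX hn0)
    have : K * (2 / (n * c)) * G ≤ v / 4 := by
      have h : K * (2 / c) * G * (4 / v) ≤ n := by linarith
      rw [show K * (2 / c) * G * (4 / v) = (K * (2 / c) * G) / (v / 4) by field_simp,
        div_le_iff₀ (by positivity)] at h
      rw [show K * (2 / (n * c)) * G = (K * (2 / c) * G) / n by field_simp,
        div_le_iff₀ hn']
      linarith
    have := mul_le_mul_of_nonneg_left this ha0.le
    calc a * (v / 4) ≤ a * (v / 2) - a * (K * (2 / (n * c)) * G) := by linarith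
      _ = _ := by ring
  have hI0 : 0 < I := lt_of_lt_of_le (by positivity) hIlow
  have hcard : (0 : ℝ) < Fintype.card Ω := by exact_mod_cast Fintype.card_pos
  set D : ℝ := (Fintype.card Ω : ℝ) ^ n / Real.pi ^ Fintype.card ι with hD
  have hD0 : 0 < D := div_pos (pow_pos hcard _) (pow_pos Real.pi_pos _)
  -- The reference value is the inversion integral at `s = 0`. It need not be a count: for odd `n`
  -- the zero margin vector has the wrong parity.
  refine ⟨D * I, by positivity, fun s d hs hd => ?_⟩
  have hcount : (sumCount X n s : ℝ) =
      D * ∫ t in halfCube ι, cosAverage X t ^ n * Real.cos (freqPairing t s) := by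
    rw [hD, div_mul_eq_mul_div, eq_div_iff (pow_pos Real.pi_pos _).ne',
      sumCount_mul_pi_pow X r hr n s hs]
  rw [hcount, ← mul_sub, abs_mul, abs_of_pos hD0, mul_left_comm]
  refine mul_le_mul_of_nonneg_left ((abs_integral_cosAverage_sub_le hc hX hn0 s hd).trans ?_) hD0.le
  have h1 : a ≤ 4 / v * I := by
    rw [div_mul_eq_mul_div, le_div_iff₀ hv0]; linarith
  calc K * d ^ 2 / 2 * (2 / (n * c) * (a * G)) = K * G / c * (d ^ 2 / n) * a := by
        field_simp
    _ ≤ K * G / c * (d ^ 2 / n) * (4 / v * I) := by gcongr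
    _ ≤ K * G / c * (d ^ 2 / n) * (4 / v * I) + d ^ 2 / n * I :=
        le_add_of_nonneg_right (by positivity)
    _ = _ := by ring

end LocalLimit

/-! ### Rankings as sign vectors and the counting of tournaments -/

section Elections

/-- The vote on each pair that a ranking casts. -/
def pairSign {k : ℕ} (σ : Ranking k) (p : AltPair k) : ℤ :=
  if σ p.1.1 < σ p.1.2 then 1 else -1

theorem pairSign_eq_one_or {k : ℕ} (σ : Ranking k) (p : AltPair k) :
    pairSign σ p = 1 ∨ pairSign σ p = -1 := by
  unfold pairSign; split_ifs <;> simp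

theorem not_lt_iff_of_altPair {k : ℕ} (σ : Ranking k) (p : AltPair k) :
    ¬ σ p.1.1 < σ p.1.2 ↔ σ p.1.2 < σ p.1.1 := by
  have : σ p.1.1 ≠ σ p.1.2 := σ.injective.ne p.2.ne
  exact ⟨fun h => lt_of_le_of_ne (not_lt.1 h) this.symm, fun h => not_lt.2 h.le⟩

theorem margin_eq_sum_pairSign {n k : ℕ} (x : Profile n k) (p : AltPair k) :
    margin x p.1.1 p.1.2 = ∑ i, pairSign (x i) p := by
  unfold margin
  rw [Finset.card_filter, Finset.card_filter]
  push_cast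
  rw [← Finset.sum_sub_distrib]
  refine Finset.sum_congr rfl fun i _ => ?_
  unfold pairSign
  by_cases h : x i p.1.1 < x i p.1.2
  · simp [h, h.le]
  · simp [h, (not_lt_iff_of_altPair _ _).1 h]

theorem pairSign_revPerm_mul {k : ℕ} (σ : Ranking k) (p : AltPair k) :
    pairSign (Equiv.mulLeft (Fin.revPerm : Ranking k) σ) p = -pairSign σ p := by
  unfold pairSign
  simp only [Equiv.coe_mulLeft, Equiv.Perm.mul_apply, Fin.revPerm_apply, Fin.rev_lt_rev]
  by_cases h : σ p.1.1 < σ p.1.2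
  · simp [h, h.le]
  · simp [h, (not_lt_iff_of_altPair _ _).1 h]

/-- Place the two alternatives in positions `0` and `1` and exchange them: being adjacent, they keep
their order relative to all others. -/
theorem exists_pairSign_flip {k : ℕ} (p : AltPair k) :
    ∃ σ τ : Ranking k, pairSign σ p = 1 ∧ pairSign τ p = -1 ∧
      ∀ q, q ≠ p → pairSign σ q = pairSign τ q := by
  obtain ⟨⟨a, b⟩, hab⟩ := p
  have hab' : a < b := hab
  obtain ⟨m, rfl⟩ : ∃ m, k = m + 2 := ⟨k - 2, by have := b.2; have : (a : ℕ) < b := hab'; omega⟩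
  obtain ⟨σ, ha, hb⟩ : ∃ σ : Ranking (m + 2), σ a = 0 ∧ σ b = 1 := by
    have h01 : (0 : Fin (m + 2)) ≠ 1 := by simp
    have hb : Equiv.swap a 0 b ≠ 0 := fun h =>
      hab'.ne' ((Equiv.swap a 0).injective (h.trans (Equiv.swap_apply_left a 0).symm))
    refine ⟨(Equiv.swap a 0).trans (Equiv.swap (Equiv.swap a 0 b) 1), ?_, ?_⟩
    · rw [Equiv.trans_apply, Equiv.swap_apply_left, Equiv.swap_apply_of_ne_of_ne hb.symm h01]
    · rw [Equiv.trans_apply, Equiv.swap_apply_left]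
  refine ⟨σ, σ.trans (Equiv.swap 0 1), ?_, ?_, ?_⟩
  · simp [pairSign, ha, hb]
  · simp [pairSign, ha, hb]
  · rintro ⟨⟨c, d⟩, hcd⟩ hne
    have hcd' : c < d := hcd
    have hcd0 : σ c ≠ σ d := σ.injective.ne hcd'.ne
    have h1 : ¬ (σ c = 0 ∧ σ d = 1) := by
      rintro ⟨h, h'⟩
      rw [← ha] at h; rw [← hb] at h'
      exact hne (Subtype.ext (Prod.ext (σ.injective h) (σ.injective h')))
    have h2 : ¬ (σ c = 1 ∧ σ d = 0) := by
      rintro ⟨h, h'⟩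
      rw [← hb] at h; rw [← ha] at h'
      rw [σ.injective h, σ.injective h'] at hcd'
      exact hcd'.asymm hab'
    have : (Equiv.swap 0 1 (σ c) < Equiv.swap 0 1 (σ d)) ↔ σ c < σ d := by
      generalize σ c = u at *
      generalize σ d = v at *
      rw [Equiv.swap_apply_def, Equiv.swap_apply_def]
      simp only [Fin.lt_def, Fin.ext_iff, ne_eq] at *
      have e0 : ((0 : Fin (m + 2)) : ℕ) = 0 := rfl
      have e1 : ((1 : Fin (m + 2)) : ℕ) = 1 := rfl
      split_ifs <;> omega
    simp [pairSign, this]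

theorem card_altPair_filter_snd {k : ℕ} (b : Fin k) :
    (Finset.univ.filter fun p : AltPair k => p.1.2 = b).card = b := by
  rw [← Fin.card_Iio b]
  refine Finset.card_bij (fun p _ => p.1.1) ?_ ?_ ?_
  · rintro ⟨⟨a, c⟩, h⟩ hc
    simp only [Finset.mem_filter, Finset.mem_univ, true_and] at hc
    subst hc
    exact Finset.mem_Iio.2 h
  · rintro ⟨⟨a, c⟩, h⟩ hc ⟨⟨a', c'⟩, h'⟩ hc' e
    simp only [Finset.mem_filter, Finset.mem_univ, true_and] at hc hc' e
    subst hc hc' e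
    rfl
  · intro a ha
    exact ⟨⟨(a, b), Finset.mem_Iio.1 ha⟩, by simp, rfl⟩

theorem card_altPair_filter_fst {k : ℕ} (a : Fin k) :
    (Finset.univ.filter fun p : AltPair k => p.1.1 = a).card = k - 1 - a := by
  rw [← Fin.card_Ioi a]
  refine Finset.card_bij (fun p _ => p.1.2) ?_ ?_ ?_
  · rintro ⟨⟨b, c⟩, h⟩ hc
    simp only [Finset.mem_filter, Finset.mem_univ, true_and] at hc
    subst hc
    exact Finset.mem_Ioi.2 h
  · rintro ⟨⟨a, c⟩, h⟩ hc ⟨⟨a', c'⟩, h'⟩ hc' e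
    simp only [Finset.mem_filter, Finset.mem_univ, true_and] at hc hc' e
    subst hc hc' e
    rfl
  · intro b hb
    exact ⟨⟨(a, b), Finset.mem_Ioi.1 hb⟩, by simp, rfl⟩

theorem card_altPair (k : ℕ) : Fintype.card (AltPair k) = k.choose 2 := by
  rw [← Finset.card_univ, Finset.card_eq_sum_card_fiberwise (t := Finset.univ)
    (f := fun p : AltPair k => p.1.2) (fun _ _ => Finset.mem_coe.2 (Finset.mem_univ _))]
  simp_rw [card_altPair_filter_snd]
  rw [Fin.sum_univ_eq_sum_range (fun i => i), Finset.sum_range_id, Nat.choose_two_right]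

theorem card_altPair_filter_mem {k : ℕ} (a : Fin k) :
    (Finset.univ.filter fun p : AltPair k => p.1.1 = a ∨ p.1.2 = a).card = k - 1 := by
  rw [Finset.filter_or, Finset.card_union_of_disjoint, card_altPair_filter_fst,
    card_altPair_filter_snd]
  · have := a.2; omega
  · rw [Finset.disjoint_filter]
    rintro p - h h'
    exact p.2.ne (h.trans h'.symm)

/-- The `±1`-valued tuples, which encode the tournaments. -/
def signTuples (k : ℕ) : Finset (AltPair k → ℤ) := Fintype.piFinset fun _ => {1, -1}

theorem mem_signTuples {k : ℕ} {y : AltPair k → ℤ} :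
    y ∈ signTuples k ↔ ∀ p, y p = 1 ∨ y p = -1 := by
  simp [signTuples]

theorem card_signTuples (k : ℕ) : (signTuples k).card = 2 ^ k.choose 2 := by
  rw [signTuples, Fintype.card_piFinset, Finset.prod_const, Finset.card_univ, card_altPair]
  rfl

theorem beats_pairSign {k : ℕ} (σ : Ranking k) (a b : Fin k) :
    Beats (pairSign σ) a b ↔ σ a < σ b := by
  unfold Beats pairSign
  rcases lt_trichotomy a b with h | rfl | h
  · simp [h, h.asymm]
  · simp
  · have : σ a ≠ σ b := σ.injective.ne h.ne'
    simp only [h.asymm, h, IsEmpty.exists_iff, exists_true_left, false_or]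
    constructor
    · intro h'
      by_contra h2
      rw [if_pos (lt_of_le_of_ne (not_lt.1 h2) this.symm)] at h'
      norm_num at h'
    · intro h'
      rw [if_neg h'.asymm]

/-- Two rankings with the same votes differ by an order automorphism of `Fin k`, which must be the
identity. -/
theorem pairSign_injective (k : ℕ) : Function.Injective (pairSign (k := k)) := by
  intro σ τ h
  have hlt : ∀ a b, σ a < σ b ↔ τ a < τ b := fun a b => by
    rw [← beats_pairSign, h, beats_pairSign]
  let e : Fin k ≃o Fin k := ⟨σ.symm.trans τ, fun {a b} => by
    rw [← not_lt, ← not_lt, Equiv.trans_apply, Equiv.trans_apply, ← hlt]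
    simp⟩
  have he : e = OrderIso.refl _ := Subsingleton.elim _ _
  ext a
  have := congrArg (fun f : Fin k ≃o Fin k => f (σ a)) he
  have h2 : τ (σ.symm (σ a)) = σ a := this
  rw [Equiv.symm_apply_apply] at h2
  rw [h2]

theorem isTransitiveOutcome_iff {k : ℕ} {y : AltPair k → ℤ} (hy : y ∈ signTuples k) :
    IsTransitiveOutcome y ↔ ∃ σ, pairSign σ = y := by
  constructor
  · rintro ⟨σ, hσ⟩
    refine ⟨σ, funext fun p => ?_⟩
    have hp : Beats y p.1.1 p.1.2 ↔ y p = 1 := by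
      have := p.2.asymm
      exact ⟨fun h => h.elim (fun ⟨_, h⟩ => h) fun ⟨h', _⟩ => absurd h' this,
        fun h => Or.inl ⟨p.2, h⟩⟩
    unfold pairSign
    rw [hσ] at hp
    split_ifs with h
    · exact (hp.1 h).symm
    · exact ((mem_signTuples.1 hy p).resolve_left (mt hp.2 h)).symm
  · rintro ⟨σ, rfl⟩
    exact ⟨σ, beats_pairSign σ⟩

open Classical in
theorem card_transitive (k : ℕ) :
    ((signTuples k).filter IsTransitiveOutcome).card = k.factorial := by
  have : (signTuples k).filter IsTransitiveOutcome = Finset.univ.image pairSign := by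
    ext y
    simp only [Finset.mem_filter, Finset.mem_image, Finset.mem_univ, true_and]
    constructor
    · rintro ⟨hy, h⟩
      exact (isTransitiveOutcome_iff hy).1 h
    · rintro ⟨σ, rfl⟩
      have hy := mem_signTuples.2 (pairSign_eq_one_or σ)
      exact ⟨hy, (isTransitiveOutcome_iff hy).2 ⟨σ, rfl⟩⟩
  rw [this, Finset.card_image_of_injective _ (pairSign_injective k), Finset.card_univ,
    Fintype.card_perm, Fintype.card_fin]

/-- The tournaments in which `a` beats all other alternatives. -/
def winnerTuples {k : ℕ} (a : Fin k) : Finset (AltPair k → ℤ) :=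
  Fintype.piFinset fun p => if p.1.1 = a then {1} else if p.1.2 = a then {-1} else {1, -1}

theorem mem_winnerTuples {k : ℕ} {a : Fin k} {y : AltPair k → ℤ} :
    y ∈ winnerTuples a ↔ y ∈ signTuples k ∧ ∀ b, b ≠ a → Beats y a b := by
  rw [winnerTuples, Fintype.mem_piFinset, mem_signTuples]
  constructor
  · intro h
    refine ⟨fun p => ?_, fun b hb => ?_⟩
    · have := h p
      split_ifs at this <;> simp_all
    · rcases hb.lt_or_gt with h' | h'
      · have := h ⟨(b, a), h'⟩
        simp only [hb, if_false, if_true, Finset.mem_singleton] at this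
        exact Or.inr ⟨h', this⟩
      · have := h ⟨(a, b), h'⟩
        simp only [if_true, Finset.mem_singleton] at this
        exact Or.inl ⟨h', this⟩
  · rintro ⟨h1, h2⟩ ⟨⟨b, c⟩, hbc⟩
    have hbc' : b < c := hbc
    dsimp only
    split_ifs with hb hc
    · subst hb
      obtain ⟨_, h⟩ | ⟨h, _⟩ := h2 c hbc'.ne'
      · simpa using h
      · exact absurd h hbc'.asymm
    · subst hc
      obtain ⟨h, _⟩ | ⟨_, h⟩ := h2 b hbc'.ne
      · exact absurd h hbc'.asymm
      · simpa using h
    · simpa using h1 ⟨(b, c), hbc⟩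

/-- A winner fixes the `k - 1` pairs that contain it and leaves the others free. The product form
avoids subtraction in the exponent. -/
theorem card_winnerTuples_mul {k : ℕ} (a : Fin k) :
    (winnerTuples a).card * 2 ^ (k - 1) = 2 ^ k.choose 2 := by
  have h : ∀ p : AltPair k, (if p.1.1 = a then ({1} : Finset ℤ) else
      if p.1.2 = a then {-1} else {1, -1}).card = if p.1.1 = a ∨ p.1.2 = a then 1 else 2 := by
    intro p
    by_cases h1 : p.1.1 = a <;> by_cases h2 : p.1.2 = a <;> simp [h1, h2]
  rw [winnerTuples, Fintype.card_piFinset, Finset.prod_congr rfl fun p _ => h p,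
    Finset.prod_ite, Finset.prod_const_one, one_mul, Finset.prod_const, ← pow_add,
    ← card_altPair_filter_mem a, add_comm, Finset.card_filter_add_card_filter_not,
    Finset.card_univ, card_altPair]

-- A tournament has at most one Condorcet winner, so the sets for different `a` are disjoint.
open Classical in
theorem card_condorcet_mul (k : ℕ) :
    ((signTuples k).filter HasCondorcetWinner).card * 2 ^ (k - 1) = k * 2 ^ k.choose 2 := by
  have : (signTuples k).filter HasCondorcetWinner = Finset.univ.biUnion winnerTuples := by
    ext y
    simp only [Finset.mem_filter, Finset.mem_biUnion, Finset.mem_univ, true_and,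
      mem_winnerTuples, HasCondorcetWinner, exists_and_left]
  rw [this, Finset.card_biUnion, Finset.sum_mul]
  · simp [card_winnerTuples_mul]
  · intro a _ b _ hab
    refine Finset.disjoint_left.2 fun y ha hb => ?_
    have h1 := (mem_winnerTuples.1 ha).2 b hab.symm
    have h2 := (mem_winnerTuples.1 hb).2 a hab
    obtain ⟨h, e⟩ | ⟨h, e⟩ := h1 <;> obtain ⟨h', e'⟩ | ⟨h', e'⟩ := h2
    · exact h.asymm h'
    · rw [e] at e'; norm_num at e'
    · rw [e] at e'; norm_num at e'
    · exact h.asymm h'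

end Elections

/-! ### From counts of margin vectors to conditional probabilities -/

section Conditioning

theorem odd_sum_of_odd {n : ℕ} (hn : Odd n) (f : Fin n → ℤ) (hf : ∀ i, Odd (f i)) :
    Odd (∑ i, f i) := by
  choose g hg using hf
  obtain ⟨m, rfl⟩ := hn
  refine ⟨∑ i, g i + m, ?_⟩
  rw [Finset.sum_congr rfl fun i _ => hg i, Finset.sum_add_distrib, ← Finset.mul_sum]
  simp
  ring

instance impartialCulture.isProbabilityMeasure (n k : ℕ) :
    IsProbabilityMeasure (impartialCulture n k) := by
  unfold impartialCulture; infer_instance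

open Classical in
theorem impartialCulture_real (n k : ℕ) (A : Set (Profile n k)) :
    (impartialCulture n k).real A =
      (Finset.univ.filter (· ∈ A)).card * ((k.factorial : ℝ)⁻¹) ^ n := by
  have hs : ∀ x : Profile n k, (impartialCulture n k).real {x} = ((k.factorial : ℝ)⁻¹) ^ n := by
    intro x
    rw [Measure.real, impartialCulture, Measure.pi_singleton, ENNReal.toReal_prod]
    simp [Fintype.card_perm]
  have hA : A = (Finset.univ.filter (· ∈ A) : Finset (Profile n k)) := by ext; simp
  conv_lhs => rw [hA]
  rw [← sum_measureReal_singleton, Finset.sum_congr rfl fun x _ => hs x, Finset.sum_const,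
    nsmul_eq_mul]

open Classical in
theorem probGivenClose_eq (n k : ℕ) (d : ℝ) (A : Set (Profile n k)) :
    probGivenClose n k d A =
      ((Finset.univ.filter fun x => x ∈ closeElections n k d ∧ x ∈ A).card : ℝ) /
        (Finset.univ.filter fun x => x ∈ closeElections n k d).card := by
  have h0 : ((k.factorial : ℝ)⁻¹) ^ n ≠ 0 :=
    pow_ne_zero _ (inv_ne_zero (by exact_mod_cast k.factorial_ne_zero))
  rw [probGivenClose, Measure.real, ProbabilityTheory.cond_apply (Set.toFinite _).measurableSet,
    ENNReal.toReal_mul, ENNReal.toReal_inv, ← Measure.real, ← Measure.real, impartialCulture_real, impartialCulture_real, ← div_eq_inv_mul,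
    mul_div_mul_right _ _ h0]
  simp only [Set.mem_inter_iff]

/-- The possible absolute values of the margins in `d`-close elections. -/
noncomputable def absMargins (k : ℕ) (d : ℝ) : Finset (AltPair k → ℤ) :=
  Fintype.piFinset fun _ => (Finset.Icc 1 ⌊d⌋).filter Odd

theorem absMargins_nonempty (k : ℕ) {d : ℝ} (hd : 1 ≤ d) : (absMargins k d).Nonempty :=
  ⟨fun _ => 1, by
    simp only [absMargins, Fintype.mem_piFinset, Finset.mem_filter, Finset.mem_Icc, le_refl,
      true_and, odd_one, and_true]
    exact fun _ => Int.le_floor.2 (by exact_mod_cast hd)⟩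

theorem odd_margin {n k : ℕ} (hn : Odd n) (x : Profile n k) (p : AltPair k) :
    Odd (margin x p.1.1 p.1.2) := by
  rw [margin_eq_sum_pairSign]
  refine odd_sum_of_odd hn _ fun i => ?_
  rcases pairSign_eq_one_or (x i) p with h | h <;> rw [h] <;> decide

theorem outcome_mem_signTuples {n k : ℕ} (hn : Odd n) (x : Profile n k) :
    outcome x ∈ signTuples k := by
  rw [mem_signTuples]
  intro p
  have hodd := odd_margin hn x p
  have h0 : margin x p.1.1 p.1.2 ≠ 0 := fun h => by rw [h] at hodd; exact absurd hodd (by decide)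
  unfold outcome
  rcases h0.lt_or_gt with h | h
  · exact Or.inr (Int.sign_eq_neg_one_of_neg h)
  · exact Or.inl (Int.sign_eq_one_of_pos h)

open Classical in
/-- The number of `d`-close profiles with outcome `y`. -/
noncomputable def closeOutcomeCount (n k : ℕ) (d : ℝ) (y : AltPair k → ℤ) : ℕ :=
  (Finset.univ.filter fun x : Profile n k => x ∈ closeElections n k d ∧ outcome x = y).card

/-- A margin is its sign times its absolute value. The index set does not depend on `y`, which makes
different outcomes comparable. -/
theorem closeOutcomeCount_eq_sum {n k : ℕ} (hn : Odd n) (d : ℝ) {y : AltPair k → ℤ}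
    (hy : y ∈ signTuples k) :
    closeOutcomeCount n k d y =
      ∑ u ∈ absMargins k d, sumCount (pairSign (k := k)) n fun p => y p * u p := by
  classical
  rw [closeOutcomeCount, Finset.card_eq_sum_card_fiberwise (t := absMargins k d)
    (f := fun x p => |margin x p.1.1 p.1.2|)]
  · refine Finset.sum_congr rfl fun u hu => ?_
    rw [sumCount, Nat.card_eq_fintype_card, Fintype.card_subtype]
    congr 1
    ext x
    simp only [Finset.mem_filter, Finset.mem_univ, true_and, ← margin_eq_sum_pairSign]
    rw [absMargins, Fintype.mem_piFinset] at hu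
    have hu' : ∀ p, 1 ≤ u p ∧ (u p : ℝ) ≤ d := fun p => by
      have := hu p
      rw [Finset.mem_filter, Finset.mem_Icc, Int.le_floor] at this
      exact this.1
    constructor
    · rintro ⟨⟨-, rfl⟩, rfl⟩ p
      exact (Int.sign_mul_abs _).symm
    · intro h
      have habs : ∀ p, |margin x p.1.1 p.1.2| = u p := fun p => by
        rw [h p, abs_mul, abs_of_pos (by linarith [(hu' p).1] : 0 < u p)]
        rcases mem_signTuples.1 hy p with e | e <;> simp [e]
      refine ⟨⟨fun p => ?_, funext fun p => ?_⟩, funext habs⟩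
      · rw [← Int.cast_abs, habs]
        exact (hu' p).2
      · have hs : (u p).sign = 1 := Int.sign_eq_one_of_pos (by linarith [(hu' p).1])
        rw [outcome, h p, Int.sign_mul, hs]
        rcases mem_signTuples.1 hy p with e | e <;> simp [e]
  · intro x hx
    have hx' : x ∈ closeElections n k d := (Finset.mem_filter.1 (Finset.mem_coe.1 hx)).2.1
    rw [Finset.mem_coe, absMargins, Fintype.mem_piFinset]
    intro p
    have ho := odd_margin hn x p
    rw [Finset.mem_filter, Finset.mem_Icc, Int.le_floor, Int.cast_abs, odd_abs]
    refine ⟨⟨?_, hx' p⟩, ho⟩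
    refine Int.one_le_abs fun h => ?_
    rw [h] at ho
    exact absurd ho (by decide)

theorem probGivenClose_outcome_mem {n k : ℕ} (hn : Odd n) (d : ℝ)
    (A : Finset (AltPair k → ℤ)) :
    probGivenClose n k d {x | outcome x ∈ A} =
      (∑ y ∈ A, (closeOutcomeCount n k d y : ℝ)) /
        ∑ y ∈ signTuples k, (closeOutcomeCount n k d y : ℝ) := by
  classical
  have key : ∀ B : Finset (AltPair k → ℤ),
      (Finset.univ.filter fun x : Profile n k =>
        x ∈ closeElections n k d ∧ outcome x ∈ B).card = ∑ y ∈ B, closeOutcomeCount n k d y := by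
    intro B
    rw [Finset.card_eq_sum_card_fiberwise (t := B) (f := outcome)]
    · refine Finset.sum_congr rfl fun y hy => ?_
      rw [closeOutcomeCount, Finset.filter_filter]
      congr 1
      ext x
      simp only [Finset.mem_filter, Finset.mem_univ, true_and]
      constructor
      · rintro ⟨⟨h, -⟩, e⟩
        exact ⟨h, e⟩
      · rintro ⟨h, rfl⟩
        exact ⟨⟨h, hy⟩, rfl⟩
    · intro x hx
      exact (Finset.mem_filter.1 (Finset.mem_coe.1 hx)).2.2
  rw [probGivenClose_eq, ← Nat.cast_sum, ← Nat.cast_sum, ← key, ← key]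
  simp only [outcome_mem_signTuples hn, and_true, Set.mem_ofPred_eq]

/-- If `δ ≤ 1/2`, the denominator is at least half of its expected value, and numerator and
denominator contribute one `δ` each, hence the `4`. If `δ > 1/2`, both ratios lie in `[0, 1]` and
the bound is trivial. No smallness of `δ` may be assumed, since `d^2/n` can be large. -/
theorem abs_sum_div_sum_sub_card_div_card_le {τ : Type*} {A B : Finset τ} (hAB : A ⊆ B)
    (hB : B.Nonempty) {f : τ → ℝ} (hf : ∀ y, 0 ≤ f y) {M δ : ℝ} (hM : 0 < M)
    (h : ∀ y ∈ B, |f y - M| ≤ δ * M) :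
    |(∑ y ∈ A, f y) / (∑ y ∈ B, f y) - (A.card : ℝ) / B.card| ≤ 4 * δ := by
  have hsum : ∀ D ⊆ B, |∑ y ∈ D, f y - D.card * M| ≤ D.card * (δ * M) := by
    intro D hD
    have e : ∑ y ∈ D, f y - D.card * M = ∑ y ∈ D, (f y - M) := by
      rw [Finset.sum_sub_distrib, Finset.sum_const, nsmul_eq_mul]
    rw [e]
    refine (Finset.abs_sum_le_sum_abs _ _).trans ?_
    refine (Finset.sum_le_sum fun y hy => h y (hD hy)).trans ?_
    rw [Finset.sum_const, nsmul_eq_mul]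
  have hA := hsum A hAB
  have hB' := hsum B subset_rfl
  have hcard : (A.card : ℝ) ≤ B.card := by exact_mod_cast Finset.card_le_card hAB
  have hBpos : (0 : ℝ) < B.card := by exact_mod_cast hB.card_pos
  have hApos : (0 : ℝ) ≤ A.card := Nat.cast_nonneg _
  have hab : ∑ y ∈ A, f y ≤ ∑ y ∈ B, f y :=
    Finset.sum_le_sum_of_subset_of_nonneg hAB fun y _ _ => hf y
  have ha0 : 0 ≤ ∑ y ∈ A, f y := Finset.sum_nonneg fun y _ => hf y
  set a := ∑ y ∈ A, f y
  set b := ∑ y ∈ B, f y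
  set α : ℝ := (A.card : ℝ)
  set β : ℝ := (B.card : ℝ)
  rcases le_or_gt δ (1 / 2) with hδ | hδ
  · have hb : β * M / 2 ≤ b := by
      have h1 := (abs_le.1 hB').1
      have h2 : β * (δ * M) ≤ β * (1 / 2 * M) := by gcongr
      linarith
    have hb0 : 0 < b := lt_of_lt_of_le (by positivity) hb
    have hδ0 : 0 ≤ δ := by
      have := (abs_nonneg _).trans hB'
      by_contra hneg
      have : β * (δ * M) < 0 := mul_neg_of_pos_of_neg hBpos (mul_neg_of_neg_of_pos (not_le.1 hneg) hM)
      linarith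
    have hnum : |a * β - b * α| ≤ 2 * δ * (α * β * M) := by
      have e : a * β - b * α = (a - α * M) * β - (b - β * M) * α := by ring
      rw [e]
      refine (abs_sub _ _).trans ?_
      rw [abs_mul, abs_mul, abs_of_pos hBpos, abs_of_nonneg hApos]
      calc _ ≤ α * (δ * M) * β + β * (δ * M) * α := by gcongr
        _ = _ := by ring
    rw [div_sub_div _ _ hb0.ne' hBpos.ne', abs_div, abs_of_pos (mul_pos hb0 hBpos),
      div_le_iff₀ (mul_pos hb0 hBpos)]
    refine hnum.trans ?_
    calc 2 * δ * (α * β * M) ≤ 2 * δ * (β * β * M) := by gcongr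
      _ = 4 * δ * (β * M / 2 * β) := by ring
      _ ≤ 4 * δ * (b * β) := by gcongr
  · have h1 : a / b ≤ 1 := div_le_one_of_le₀ hab (ha0.trans hab)
    have h2 : 0 ≤ a / b := div_nonneg ha0 (ha0.trans hab)
    have h3 : α / β ≤ 1 := div_le_one_of_le₀ hcard hBpos.le
    have h4 : 0 ≤ α / β := by positivity
    rw [abs_le]
    constructor <;> linarith

theorem abs_pairSign_le_one {k : ℕ} (σ : Ranking k) (p : AltPair k) :
    |(pairSign σ p : ℝ)| ≤ 1 := by
  rcases pairSign_eq_one_or σ p with h | h <;> simp [h]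

/-- Under `d`-close elections all tournaments are almost equally likely. -/
theorem exists_abs_probGivenClose_sub_le (k : ℕ) :
    ∃ C : ℝ, 0 < C ∧ ∃ N : ℕ, ∀ n, N ≤ n → Odd n → ∀ d : ℝ, 1 ≤ d →
      ∀ A ⊆ signTuples k, |probGivenClose n k d {x | outcome x ∈ A} -
        (A.card : ℝ) / 2 ^ k.choose 2| ≤ C * (d ^ 2 / n) := by
  obtain ⟨C, hC, N, h⟩ := exists_abs_sumCount_sub_le (pairSign (k := k)) abs_pairSign_le_one _
    pairSign_revPerm_mul exists_pairSign_flip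
  refine ⟨4 * C, by positivity, N, fun n hNn hn d hd A hA => ?_⟩
  obtain ⟨J, hJ, hcount⟩ := h n hNn
  have hU : (0 : ℝ) < (absMargins k d).card := by
    exact_mod_cast (absMargins_nonempty k hd).card_pos
  have hB : (signTuples k).Nonempty := by
    rw [← Finset.card_pos, card_signTuples]; positivity
  have hcast : ((signTuples k).card : ℝ) = 2 ^ k.choose 2 := by
    rw [card_signTuples]; push_cast; rfl
  rw [probGivenClose_outcome_mem hn, ← hcast, mul_assoc]
  -- The common value `M` is `J` times the number of vectors of absolute margins.
  refine abs_sum_div_sum_sub_card_div_card_le hA hB (fun y => Nat.cast_nonneg _)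
    (mul_pos hU hJ) fun y hy => ?_
  rw [closeOutcomeCount_eq_sum hn d hy, Nat.cast_sum, ← nsmul_eq_mul, ← Finset.sum_const,
    ← Finset.sum_sub_distrib, Finset.mul_sum]
  refine (Finset.abs_sum_le_sum_abs _ _).trans (Finset.sum_le_sum fun u hu => ?_)
  rw [absMargins, Fintype.mem_piFinset] at hu
  have hu' : ∀ p, (1 ≤ u p ∧ (u p : ℝ) ≤ d) ∧ Odd (u p) := fun p => by
    have := hu p
    rwa [Finset.mem_filter, Finset.mem_Icc, Int.le_floor] at this
  refine hcount _ d (fun x p => ?_) fun p => ?_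
  · refine Odd.sub_odd ?_ ?_
    · rw [← margin_eq_sum_pairSign]
      exact odd_margin hn x p
    · refine Odd.mul ?_ (hu' p).2
      rcases mem_signTuples.1 hy p with e | e <;> rw [e] <;> decide
  · have h1 : (1 : ℝ) ≤ u p := by exact_mod_cast (hu' p).1.1
    have : |((y p * u p : ℤ) : ℝ)| = u p := by
      push_cast
      rw [abs_mul, abs_of_pos (by linarith : (0 : ℝ) < u p)]
      rcases mem_signTuples.1 hy p with e | e <;> simp [e]
    rw [this]
    exact (hu' p).1.2

theorem abs_probGivenClose_sub_le_one {n k : ℕ} (d : ℝ) {A : Finset (AltPair k → ℤ)}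
    (hA : A ⊆ signTuples k) (E : Set (Profile n k)) :
    |probGivenClose n k d E - (A.card : ℝ) / 2 ^ k.choose 2| ≤ 1 := by
  have h1 : probGivenClose n k d E ≤ 1 := by
    rw [probGivenClose]; exact measureReal_le_one
  have h2 : 0 ≤ probGivenClose n k d E := measureReal_nonneg
  have h3 : (A.card : ℝ) / 2 ^ k.choose 2 ≤ 1 := by
    refine div_le_one_of_le₀ ?_ (by positivity)
    have := Finset.card_le_card hA
    rw [card_signTuples] at this
    exact_mod_cast this
  have h4 : 0 ≤ (A.card : ℝ) / 2 ^ k.choose 2 := by positivity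
  rw [abs_le]
  constructor <;> linarith

/-- Uniformity over all sets `A` of tournaments lets one constant and one `ε` serve all three
claims. -/
theorem exists_uniform_bound (k : ℕ) :
    ∃ C : ℝ, 0 < C ∧ ∃ ε : ℕ → ℝ, Tendsto ε atTop (𝓝 0) ∧
      ∀ n : ℕ, Odd n → ∀ d : ℝ, 1 ≤ d → ∀ A ⊆ signTuples k,
        |probGivenClose n k d {x | outcome x ∈ A} - (A.card : ℝ) / 2 ^ k.choose 2| ≤
          C * (d ^ 2 / (n : ℝ)) + ε n := by
  obtain ⟨C, hC, N, h⟩ := exists_abs_probGivenClose_sub_le k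
  -- Below `N` the trivial bound `1` is used, so `ε` is eventually zero.
  refine ⟨C, hC, fun n => if N ≤ n then 0 else 1, ?_, fun n hn d hd A hA => ?_⟩
  · refine tendsto_const_nhds.congr' ?_
    filter_upwards [eventually_ge_atTop N] with n hn
    rw [if_pos hn]
  · by_cases hNn : N ≤ n
    · simpa [hNn] using h n hNn hn d hd A hA
    · have h1 := abs_probGivenClose_sub_le_one d hA {x : Profile n k | outcome x ∈ A}
      have h2 : 0 ≤ C * (d ^ 2 / (n : ℝ)) := by positivity
      simp only [hNn, if_false]
      linarith

end Conditioning

theorem mainTheorem2 (k : ℕ) (hk : 1 ≤ k) :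
    (∃ α : ℝ, 0 < α ∧ ∃ ε : ℕ → ℝ, Tendsto ε atTop (𝓝 0) ∧
      ∀ n : ℕ, Odd n → ∀ d : ℝ, 1 ≤ d →
        ∀ y : AltPair k → ℤ, (∀ p, y p = 1 ∨ y p = -1) →
          |probGivenClose n k d {x | outcome x = y} - 1 / (2 : ℝ) ^ k.choose 2| ≤
            α * (d ^ 2 / (n : ℝ)) + ε n) ∧
    (∃ β : ℝ, 0 < β ∧ ∃ ε : ℕ → ℝ, Tendsto ε atTop (𝓝 0) ∧
      ∀ n : ℕ, Odd n → ∀ d : ℝ, 1 ≤ d →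
        |probGivenClose n k d {x | IsTransitiveOutcome (outcome x)} -
            (k.factorial : ℝ) / (2 : ℝ) ^ k.choose 2| ≤
          β * (d ^ 2 / (n : ℝ)) + ε n) ∧
    (∃ γ : ℝ, 0 < γ ∧ ∃ ε : ℕ → ℝ, Tendsto ε atTop (𝓝 0) ∧
      ∀ n : ℕ, Odd n → ∀ d : ℝ, 1 ≤ d →
        |probGivenClose n k d {x | HasCondorcetWinner (outcome x)} -
            (k : ℝ) / (2 : ℝ) ^ (k - 1)| ≤
          γ * (d ^ 2 / (n : ℝ)) + ε n) := by
  classical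
  obtain ⟨C, hC, ε, hε, h⟩ := exists_uniform_bound k
  refine ⟨⟨C, hC, ε, hε, fun n hn d hd y hy => ?_⟩, ⟨C, hC, ε, hε, fun n hn d hd => ?_⟩,
    ⟨C, hC, ε, hε, fun n hn d hd => ?_⟩⟩
  · have := h n hn d hd {y} (Finset.singleton_subset_iff.2 (mem_signTuples.2 hy))
    simpa only [Finset.mem_singleton, Finset.card_singleton, Nat.cast_one] using this
  · have := h n hn d hd _ (Finset.filter_subset IsTransitiveOutcome _)
    simpa only [Finset.mem_filter, outcome_mem_signTuples hn, true_and, card_transitive] using this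
  · have := h n hn d hd _ (Finset.filter_subset HasCondorcetWinner _)
    have hc : (((signTuples k).filter HasCondorcetWinner).card : ℝ) / 2 ^ k.choose 2 =
        (k : ℝ) / 2 ^ (k - 1) := by
      rw [div_eq_div_iff (by positivity) (by positivity)]
      exact_mod_cast card_condorcet_mul k
    rw [hc] at this
    simpa only [Finset.mem_filter, outcome_mem_signTuples hn, true_and] using this
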